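/- For a partition $\lambda$ let $\omega(\lambda)$ be the number of parts equal to $1$ and $\mu(\lambda)$ the number of parts larger than $\omega(\lambda)$. The (Andrews--Garvan) crank of $\lambda$ is the largest part of $\lambda$ if $\omega(\lambda)=0$, and $\mu(\lambda)-\omega(\lambda)$ if $\omega(\lambda)>0$; the empty partition has crank $0$. For an integer $j$ and $n\ge 0$, $n\neq 1$, let $C_j(n)$ be the number of partitions $\lambda$ of $n$ with $\operatorname{crank}(\lambda)\ge j$. For $n=1$ put $C_j(1)=\sum_{m\ge j}M(m,1)$, where, as is customary for the crank generating function, $M(0,1)=-1$, $M(1,1)=M(-1,1)=1$ and $M(m,1)=0$ for $|m|\ge 2$. (This differs from the actual number of partitions of $1$ with crank $\ge j$ only for $j=1$, where $C_1(1)=1$.) Write $(q)_\infty=\prod_{i\ge1}(1-q^i)$. Then for every integer $j$ (positive, negative or zero), as formal Laurent series in $q$, both sums on the right being formally convergent, $$\sum_{n\ge0}C_j(n)\,q^n=\frac1{(q)_\infty}\sum_{k=0}^{\infty}q^{j(2k+1)+k(2k+1)}\bigl(1-q^{2k+j+1}\bigr),$$ and equivalently $$\sum_{n\ge0}C_j(n)\,q^n=\frac1{(q)_\infty}\sum_{n=1}^{\infty}(-1)^{n-1}q^{n(n-1)/2+nj}.$$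 -/

import Mathlib

noncomputable section

namespace CrankGF

/-- The Andrews-Garvan crank of a partition: the largest part if `1` is not a part; otherwise
`μ - ω`, where `ω` is the number of ones and `μ` is the number of parts larger than `ω`.
The empty partition gets crank `0`. -/
def crank {n : ℕ} (p : n.Partition) : ℤ :=
  if p.parts.count 1 = 0 then (p.parts.sup : ℤ)
  else ((p.parts.filter (fun i => p.parts.count 1 < i)).card : ℤ) - (p.parts.count 1 : ℤ)

/-- The customary exceptional values at `n = 1` of the crank counting function `M(m, n)`:
`M(0, 1) = -1`, `M(1, 1) = M(-1, 1) = 1` and `M(m, 1) = 0` for all other `m`. -/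
def crankOne (m : ℤ) : ℤ :=
  if m = 0 then -1 else if m = 1 ∨ m = -1 then 1 else 0

/-- For `n ≠ 1`, the number of partitions of `n` with crank at least `j`. For `n = 1` it is
`∑_{m ≥ j} M(m, 1)`, with the customary values of `M(m, 1)`. -/
def numCrankGe (j : ℤ) (n : ℕ) : ℤ :=
  if n = 1 then ∑ m ∈ Finset.Icc j 1, crankOne m
  else ((Finset.univ.filter (fun p : n.Partition => j ≤ crank p)).card : ℤ)

/-- The generating function `∑_{n ≥ 0} numCrankGe j n * q ^ n`. -/
def crankGeGF (j : ℤ) : PowerSeries ℚ :=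
  PowerSeries.mk (fun n => (numCrankGe j n : ℚ))

section Euler

open scoped PowerSeries.WithPiTopology

/-- `(q)_∞ = ∏_{i ≥ 1} (1 - q ^ i)`, a convergent product of formal power series. -/
def qInf : PowerSeries ℚ :=
  ∏' i : ℕ, (1 - PowerSeries.X ^ (i + 1))

/-- The infinite product defining `qInf` does converge. -/
theorem multipliable_qInf :
    Multipliable (fun i : ℕ => (1 - PowerSeries.X ^ (i + 1) : PowerSeries ℚ)) :=
  PowerSeries.WithPiTopology.multipliable_one_sub_X_pow ℚ

end Euler

/-- The monomial `q ^ e` with integer exponent, as a formal Laurent series. -/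
def qPow (e : ℤ) : LaurentSeries ℚ :=
  HahnSeries.single e (1 : ℚ)

end CrankGF

end

namespace CrankGF

open PowerSeries Filter
open scoped PowerSeries.WithPiTopology

/-! Write C_j for the left side, P = 1/(q)_∞ and (q)_w for the finite product. For m ≥ 0, sorting
partitions of crank m by their number w of ones gives C_m - C_{m+1} = ∑_w (1-q) q^(w+(w+1)(w+m)) /
((q)_w (q)_{w+m}). The customary values at n = 1 are exactly what makes the term w = 0 fit. Sorting
crank -m (m > 0) by the number of parts exceeding ω gives the same series, so the crank is symmetric
and C_{-m} + C_{m+1} = P.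

With S_j = `durfeeSum j`, shifting indices and telescoping gives C_m = q^m S_m, and another shift
shows that S_j + q^(j+1) S_{j+1} does not depend on j. At j = 0 it is C_0 + C_1 = P. Hence C_m + q^m
C_{m+1} = q^m P (`crankGeGF_recurrence`).

The alternating sums T_j of `triFamily` satisfy T_j + q^j T_{j+1} = q^j, so (q)_∞ C_m - T_m is
divisible by arbitrarily high powers of q and vanishes for m ≥ 0. Negative j follow by reflection,
and pairing consecutive terms of T_j gives the first formula. -/

/-- The generating function of the partitions whose multiset of parts satisfies `Q`. -/
noncomputable def gf (Q : Multiset ℕ → Prop) : PowerSeries ℚ :=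
  PowerSeries.mk fun n => (Nat.card {p : n.Partition // Q p.parts} : ℚ)

/-! ### Calculus of partition generating functions -/

theorem coeff_gf (Q : Multiset ℕ → Prop) (n : ℕ) :
    coeff n (gf Q) = (Nat.card {p : n.Partition // Q p.parts} : ℚ) := by
  simp [gf]

theorem gf_congr {Q Q' : Multiset ℕ → Prop}
    (hQ : ∀ s : Multiset ℕ, (∀ i ∈ s, 0 < i) → (Q s ↔ Q' s)) : gf Q = gf Q' := by
  ext n
  rw [coeff_gf, coeff_gf]
  congr 1
  exact Nat.card_congr (Equiv.subtypeEquivRight fun p => hQ _ fun i hi => p.parts_pos hi)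

theorem coeff_gf_eq_zero {Q : Multiset ℕ → Prop} {n : ℕ}
    (hQ : ∀ p : n.Partition, ¬ Q p.parts) : coeff n (gf Q) = 0 := by
  rw [coeff_gf]
  have : IsEmpty {p : n.Partition // Q p.parts} := ⟨fun p => hQ p.1 p.2⟩
  simp

theorem gf_eq_zero {Q : Multiset ℕ → Prop}
    (hQ : ∀ s : Multiset ℕ, (∀ i ∈ s, 0 < i) → ¬ Q s) : gf Q = 0 := by
  ext n
  rw [coeff_gf_eq_zero fun p => hQ _ fun i hi => p.parts_pos hi, map_zero]

theorem gf_eq_zero_parts : gf (fun s => s = 0) = 1 := by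
  ext n
  rw [PowerSeries.coeff_one]
  split_ifs with hn
  · subst hn
    rw [coeff_gf]
    simp
  · refine coeff_gf_eq_zero fun p hp => hn ?_
    rw [← p.parts_sum, hp, Multiset.sum_zero]

theorem gf_and_add_gf_and_not (Q R : Multiset ℕ → Prop) :
    gf (fun s => Q s ∧ R s) + gf (fun s => Q s ∧ ¬ R s) = gf Q := by
  classical
  ext n
  rw [map_add, coeff_gf, coeff_gf, coeff_gf, Nat.card_eq_fintype_card, Nat.card_eq_fintype_card,
    Nat.card_eq_fintype_card, Fintype.card_subtype, Fintype.card_subtype, Fintype.card_subtype,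
    ← Finset.filter_filter, ← Finset.filter_filter]
  exact_mod_cast Finset.card_filter_add_card_filter_not _

/-- Erasing one copy of `a` is a bijection onto the partitions of `n - a`. -/
theorem gf_and_mem (Q : Multiset ℕ → Prop) {a : ℕ} (ha : 1 ≤ a) :
    gf (fun s => Q s ∧ a ∈ s) = X ^ a * gf (fun s => Q (a ::ₘ s)) := by
  ext n
  rw [coeff_X_pow_mul', coeff_gf]
  split_ifs with h
  · rw [coeff_gf]
    congr 1
    refine Nat.card_congr ?_
    calc {p : n.Partition // Q p.parts ∧ a ∈ p.parts}
        ≃ {p : n.Partition // a ∈ p.parts ∧ Q p.parts} :=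
          Equiv.subtypeEquivRight fun p => and_comm
      _ ≃ {p : {p : n.Partition // a ∈ p.parts} // Q p.1.parts} :=
          (Equiv.subtypeSubtypeEquivSubtypeInter _ _).symm
      _ ≃ {p : (n - a).Partition // Q (a ::ₘ p.parts)} :=
          Equiv.subtypeEquiv (Nat.Partition.partitionWithPartEquiv ha h) fun p => by
            rw [Nat.Partition.partitionWithPartEquiv_apply_parts, Multiset.cons_erase p.2]
  · have : IsEmpty {p : n.Partition // Q p.parts ∧ a ∈ p.parts} :=
      ⟨fun p => h (Nat.Partition.le_of_mem_parts p.2.2)⟩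
    simp

/-- Partitions either avoid the part `a`, or arise by inserting a part `a`. -/
theorem gf_insert (Q : Multiset ℕ → Prop) {a : ℕ} (ha : 1 ≤ a) :
    gf Q = gf (fun s => Q s ∧ a ∉ s) + X ^ a * gf (fun s => Q (a ::ₘ s)) := by
  rw [← gf_and_mem Q ha, add_comm, gf_and_add_gf_and_not]

/-- Splitting a generating function according to a statistic. -/
theorem hasSum_gf (Q : Multiset ℕ → Prop) (φ : Multiset ℕ → ℕ) :
    HasSum (fun w => gf fun s => Q s ∧ φ s = w) (gf Q) := by
  classical
  rw [WithPiTopology.hasSum_iff_hasSum_coeff]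
  intro n
  have key : coeff n (gf Q) = ∑ w ∈ Finset.univ.image (fun p : n.Partition => φ p.parts),
      coeff n (gf fun s => Q s ∧ φ s = w) := by
    simp_rw [coeff_gf, Nat.card_eq_fintype_card, Fintype.card_subtype]
    rw [Finset.card_eq_sum_card_fiberwise (f := fun p : n.Partition => φ p.parts)
      (t := Finset.univ.image (fun p : n.Partition => φ p.parts))]
    · push_cast
      simp_rw [Finset.filter_filter]
    · intro p _
      simp
  rw [key]
  refine hasSum_sum_of_ne_finset_zero fun w hw => coeff_gf_eq_zero fun p hp => hw ?_
  rw [Finset.mem_image]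
  exact ⟨p, Finset.mem_univ _, hp.2⟩

/-! ### Partitions with prescribed parts, as q-factorial quotients -/

/-- The reciprocal of the `q`-factorial `(1 - q) ⋯ (1 - q ^ k)`. -/
noncomputable def qFacInv (k : ℕ) : PowerSeries ℚ :=
  (∏ i ∈ Finset.range k, (1 - X ^ (i + 1)))⁻¹

@[simp]
theorem qFacInv_zero : qFacInv 0 = 1 := by
  simp [qFacInv]

theorem qFacInv_succ (k : ℕ) : qFacInv (k + 1) * (1 - X ^ (k + 1)) = qFacInv k := by
  rw [qFacInv, qFacInv, Finset.prod_range_succ, PowerSeries.mul_inv_rev, mul_comm, ← mul_assoc,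
    PowerSeries.mul_inv_cancel _ (by simp), one_mul]

theorem qFacInv_one : qFacInv 1 * (1 - X) = 1 := by
  simpa using qFacInv_succ 0

theorem forall_succ_lt_iff {v : ℕ} {s : Multiset ℕ} :
    (∀ i ∈ s, v + 1 < i) ↔ (∀ i ∈ s, v < i) ∧ v + 1 ∉ s := by
  constructor
  · exact fun h =>
      ⟨fun i hi => (Nat.lt_succ_self v).trans (h i hi), fun h' => lt_irrefl _ (h _ h')⟩
  · rintro ⟨h, h'⟩ i hi
    refine lt_of_le_of_ne (h i hi) ?_
    rintro rfl
    exact h' hi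

theorem count_one_eq_zero_iff {s : Multiset ℕ} (hs : ∀ i ∈ s, 0 < i) :
    s.count 1 = 0 ↔ ∀ i ∈ s, 1 < i := by
  rw [Multiset.count_eq_zero, forall_succ_lt_iff]
  exact (and_iff_right hs).symm

/-- Partitions into `N` parts, all larger than `w`. -/
theorem gf_card_parts_gt (N w : ℕ) :
    gf (fun s => (∀ i ∈ s, w < i) ∧ s.card = N) = X ^ ((w + 1) * N) * qFacInv N := by
  induction N generalizing w with
  | zero =>
    rw [mul_zero, pow_zero, qFacInv_zero, mul_one, ← gf_eq_zero_parts]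
    refine gf_congr fun s _ => ?_
    rw [Multiset.card_eq_zero]
    exact ⟨fun h => h.2, fun h => ⟨by simp [h], h⟩⟩
  | succ N ih =>
    -- Both sides obey the same recurrence in `w`, so their difference is independent of `w`; each
    -- of its coefficients vanishes once `w` is large.
    set D : ℕ → PowerSeries ℚ := fun w =>
      gf (fun s => (∀ i ∈ s, w < i) ∧ s.card = N + 1) - X ^ ((w + 1) * (N + 1)) * qFacInv (N + 1)
      with hD
    have step : ∀ w, D w = D (w + 1) := by
      intro w
      have h1 : gf (fun s => ((∀ i ∈ s, w < i) ∧ s.card = N + 1) ∧ w + 1 ∉ s) =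
          gf (fun s => (∀ i ∈ s, w + 1 < i) ∧ s.card = N + 1) := by
        refine gf_congr fun s _ => ?_
        rw [forall_succ_lt_iff, and_right_comm]
      have h2 : gf (fun s => (∀ i ∈ (w + 1) ::ₘ s, w < i) ∧ ((w + 1) ::ₘ s).card = N + 1) =
          gf (fun s => (∀ i ∈ s, w < i) ∧ s.card = N) :=
        gf_congr fun s _ => by simp
      simp only [hD]
      rw [gf_insert _ (Nat.le_add_left 1 w), h1, h2, ih w, ← qFacInv_succ N]
      ring
    have steps : ∀ k, D w = D (w + k) := by
      intro k
      induction k with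
      | zero => rfl
      | succ k ih => rw [ih, step, add_assoc]
    have hzero : D w = 0 := by
      ext n
      rw [steps n, map_zero]
      simp only [hD]
      rw [map_sub, coeff_X_pow_mul', if_neg (by nlinarith), coeff_gf_eq_zero, sub_zero]
      rintro p ⟨h, h'⟩
      obtain ⟨i, hi⟩ := Multiset.card_pos_iff_exists_mem.1 (h'.symm ▸ Nat.succ_pos N : 0 < p.parts.card)
      have := h i hi
      have := Nat.Partition.le_of_mem_parts hi
      omega
    exact sub_eq_zero.1 hzero

/-- Partitions into parts larger than `v`, with `N` parts larger than `w`. -/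
theorem gf_card_filter_parts_gt (N : ℕ) {v w : ℕ} (hvw : v ≤ w) :
    gf (fun s => (∀ i ∈ s, v < i) ∧ (s.filter (w < ·)).card = N) * qFacInv v =
      qFacInv w * (X ^ ((w + 1) * N) * qFacInv N) := by
  induction hvw using Nat.decreasingInduction with
  | self =>
    rw [mul_comm, ← gf_card_parts_gt]
    congr 1
    refine gf_congr fun s _ => and_congr_right fun h => ?_
    rw [Multiset.filter_eq_self.2 h]
  | of_succ v hv ih =>
    rw [← ih, ← qFacInv_succ v]
    -- Since `v + 1 ≤ w`, a part `v + 1` is invisible to the filter, so allowing it only contributes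
    -- a factor 1/(1 - q^(v+1)).
    have h1 : gf (fun s => ((∀ i ∈ s, v < i) ∧ (s.filter (w < ·)).card = N) ∧ v + 1 ∉ s) =
        gf (fun s => (∀ i ∈ s, v + 1 < i) ∧ (s.filter (w < ·)).card = N) := by
      refine gf_congr fun s _ => ?_
      rw [forall_succ_lt_iff, and_right_comm]
    have h2 : gf (fun s => (∀ i ∈ (v + 1) ::ₘ s, v < i) ∧
          (((v + 1) ::ₘ s).filter (w < ·)).card = N) =
        gf (fun s => (∀ i ∈ s, v < i) ∧ (s.filter (w < ·)).card = N) :=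
      gf_congr fun s _ => by
        rw [Multiset.filter_cons_of_neg _ (by omega)]
        simp
    have h3 := gf_insert (fun s => (∀ i ∈ s, v < i) ∧ (s.filter (w < ·)).card = N)
      (Nat.le_add_left 1 v)
    rw [h1, h2] at h3
    linear_combination qFacInv (v + 1) * h3

/-- Partitions with exactly `c` ones and `N` parts larger than `w`. -/
theorem gf_count_one_card_filter (N c : ℕ) {w : ℕ} (hw : 1 ≤ w) :
    gf (fun s => s.count 1 = c ∧ (s.filter (w < ·)).card = N) =
      X ^ c * (1 - X) * qFacInv w * (X ^ ((w + 1) * N) * qFacInv N) := by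
  induction c with
  | zero =>
    have h1 := gf_card_filter_parts_gt N hw
    have h2 : gf (fun s => s.count 1 = 0 ∧ (s.filter (w < ·)).card = N) =
        gf (fun s => (∀ i ∈ s, 1 < i) ∧ (s.filter (w < ·)).card = N) := by
      refine gf_congr fun s hs => and_congr_left fun _ => ?_
      exact count_one_eq_zero_iff hs
    rw [h2]
    linear_combination (1 - X) * h1 -
      gf (fun s => (∀ i ∈ s, 1 < i) ∧ (s.filter (w < ·)).card = N) * qFacInv_one
  | succ c ih =>
    rw [gf_insert _ le_rfl, gf_eq_zero, zero_add, pow_succ]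
    · have h2 : gf (fun s => (1 ::ₘ s).count 1 = c + 1 ∧ ((1 ::ₘ s).filter (w < ·)).card = N) =
          gf (fun s => s.count 1 = c ∧ (s.filter (w < ·)).card = N) :=
        gf_congr fun s _ => by
          rw [Multiset.filter_cons_of_neg _ (by omega)]
          simp
      rw [h2, ih]
      ring
    · rintro s _ ⟨⟨h, _⟩, h'⟩
      rw [Multiset.count_eq_zero.2 h'] at h
      omega

theorem sup_eq_zero_iff_of_pos {s : Multiset ℕ} (hs : ∀ i ∈ s, 0 < i) : s.sup = 0 ↔ s = 0 := by
  constructor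
  · intro h
    refine Multiset.eq_zero_of_forall_notMem fun i hi => ?_
    have := Multiset.le_sup hi
    have := hs i hi
    omega
  · rintro rfl
    rfl

theorem sup_mem_of_ne_zero {s : Multiset ℕ} (hs : s.sup ≠ 0) : s.sup ∈ s := by
  induction s using Multiset.induction_on with
  | empty => simp at hs
  | cons a s ih =>
    rw [Multiset.sup_cons] at hs ⊢
    rcases le_total s.sup a with h | h
    · simp [h]
    · rw [sup_eq_right.2 h] at hs ⊢
      exact Multiset.mem_cons_of_mem (ih hs)

/-- Partitions into parts larger than `v` with largest part `m + 1`. -/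
theorem gf_sup_parts_gt {v m : ℕ} (hv : v ≤ m) :
    gf (fun s => (∀ i ∈ s, v < i) ∧ s.sup = m + 1) * qFacInv v =
      X ^ (m + 1) * qFacInv (m + 1) := by
  induction hv using Nat.decreasingInduction with
  | self =>
    have h1 : gf (fun s => (∀ i ∈ s, m < i) ∧ s.sup ≤ m + 1) * (1 - X ^ (m + 1)) = 1 := by
      have h2 : gf (fun s => ((∀ i ∈ s, m < i) ∧ s.sup ≤ m + 1) ∧ m + 1 ∉ s) = 1 := by
        rw [← gf_eq_zero_parts]
        refine gf_congr fun s hs => ?_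
        constructor
        · rintro ⟨⟨h, h'⟩, h''⟩
          refine Multiset.eq_zero_of_forall_notMem fun i hi => ?_
          have := h i hi
          have := (Multiset.le_sup hi).trans h'
          have : i = m + 1 := by omega
          exact h'' (this ▸ hi)
        · rintro rfl
          simp
      have h3 : gf (fun s => (∀ i ∈ (m + 1) ::ₘ s, m < i) ∧ ((m + 1) ::ₘ s).sup ≤ m + 1) =
          gf (fun s => (∀ i ∈ s, m < i) ∧ s.sup ≤ m + 1) :=
        gf_congr fun s _ => by simp [Multiset.sup_cons]
      have h4 := gf_insert (fun s => (∀ i ∈ s, m < i) ∧ s.sup ≤ m + 1)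
        (Nat.le_add_left 1 m)
      rw [h2, h3] at h4
      linear_combination h4
    have h5 : gf (fun s => (∀ i ∈ (m + 1) ::ₘ s, m < i) ∧ ((m + 1) ::ₘ s).sup = m + 1) =
        gf (fun s => (∀ i ∈ s, m < i) ∧ s.sup ≤ m + 1) :=
      gf_congr fun s _ => by simp [Multiset.sup_cons]
    rw [gf_insert _ (Nat.le_add_left 1 m), gf_eq_zero, zero_add, h5, ← qFacInv_succ m]
    · linear_combination X ^ (m + 1) * qFacInv (m + 1) * h1
    · rintro s _ ⟨⟨_, h⟩, h'⟩
      refine h' ?_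
      rw [← h]
      exact sup_mem_of_ne_zero (by omega)
  | of_succ v hv ih =>
    rw [← ih, ← qFacInv_succ v]
    have h1 : gf (fun s => ((∀ i ∈ s, v < i) ∧ s.sup = m + 1) ∧ v + 1 ∉ s) =
        gf (fun s => (∀ i ∈ s, v + 1 < i) ∧ s.sup = m + 1) := by
      refine gf_congr fun s _ => ?_
      rw [forall_succ_lt_iff, and_right_comm]
    have h2 : gf (fun s => (∀ i ∈ (v + 1) ::ₘ s, v < i) ∧ ((v + 1) ::ₘ s).sup = m + 1) =
        gf (fun s => (∀ i ∈ s, v < i) ∧ s.sup = m + 1) := by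
      refine gf_congr fun s _ => ?_
      rw [Multiset.sup_cons]
      have : (v + 1) ⊔ s.sup = m + 1 ↔ s.sup = m + 1 := by
        omega
      simp [this]
    have h3 := gf_insert (fun s => (∀ i ∈ s, v < i) ∧ s.sup = m + 1)
      (Nat.le_add_left 1 v)
    rw [h1, h2] at h3
    linear_combination qFacInv (v + 1) * h3

/-- Partitions without ones and with largest part `m + 2`. -/
theorem gf_count_one_eq_zero_sup (m : ℕ) :
    gf (fun s => s.count 1 = 0 ∧ s.sup = m + 2) = (1 - X) * (X ^ (m + 2) * qFacInv (m + 2)) := by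
  have h1 := gf_sup_parts_gt (Nat.le_add_left 1 m)
  have h2 : gf (fun s => s.count 1 = 0 ∧ s.sup = m + 2) =
      gf (fun s => (∀ i ∈ s, 1 < i) ∧ s.sup = m + 1 + 1) := by
    refine gf_congr fun s hs => and_congr_left fun _ => ?_
    exact count_one_eq_zero_iff hs
  rw [h2]
  linear_combination (1 - X) * h1 -
    gf (fun s => (∀ i ∈ s, 1 < i) ∧ s.sup = m + 1 + 1) * qFacInv_one

theorem gf_count_one_eq_zero_sup_zero : gf (fun s => s.count 1 = 0 ∧ s.sup = 0) = 1 := by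
  rw [← gf_eq_zero_parts]
  refine gf_congr fun s hs => ?_
  rw [sup_eq_zero_iff_of_pos hs]
  constructor
  · exact fun h => h.2
  · rintro rfl
    simp

theorem gf_count_one_eq_zero_sup_one : gf (fun s => s.count 1 = 0 ∧ s.sup = 1) = 0 := by
  refine gf_eq_zero fun s _ h => ?_
  refine Multiset.count_eq_zero.1 h.1 ?_
  have := sup_mem_of_ne_zero (s := s) (by omega)
  rwa [h.2] at this

/-- The generating function of all partitions is the reciprocal of `(q)_∞`. -/
theorem gf_true_mul_qInf : gf (fun _ => True) * qInf = 1 := by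
  have h1 : gf (fun _ => True) = ∏' i : ℕ, ∑' j : ℕ, (X : PowerSeries ℚ) ^ ((i + 1) * j) := by
    have := Nat.Partition.powerSeriesMk_card_restricted_eq_tprod ℚ (fun _ => True)
    simp only [if_true] at this
    rw [← this]
    ext n
    rw [coeff_gf, coeff_mk, Nat.Partition.restricted]
    simp
  have h2 : Multipliable fun i : ℕ => ∑' j : ℕ, (X : PowerSeries ℚ) ^ ((i + 1) * j) := by
    simpa using Nat.Partition.multipliable_powerSeriesMk_card_restricted ℚ (fun _ => True)
  rw [h1, qInf, ← h2.tprod_mul multipliable_qInf]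
  simp_rw [pow_mul]
  conv_lhs =>
    arg 1
    ext i
    rw [WithPiTopology.tsum_pow_mul_one_sub_of_constantCoeff_eq_zero (by simp)]
  exact tprod_one

/-! ### The crank statistic and its symmetry -/

/-- The crank of a multiset of parts. -/
def multisetCrank (s : Multiset ℕ) : ℤ :=
  if s.count 1 = 0 then (s.sup : ℤ)
  else ((s.filter (fun i => s.count 1 < i)).card : ℤ) - (s.count 1 : ℤ)

theorem card_le_sum_of_pos {s : Multiset ℕ} (hs : ∀ i ∈ s, 0 < i) : s.card ≤ s.sum := by
  simpa using Multiset.card_nsmul_le_sum (a := 1) hs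

theorem multisetCrank_le_sum {s : Multiset ℕ} (hs : ∀ i ∈ s, 0 < i) :
    multisetCrank s ≤ s.sum := by
  rw [multisetCrank]
  split_ifs
  · by_cases h : s.sup = 0
    · rw [h]
      exact_mod_cast Nat.zero_le _
    · exact_mod_cast Multiset.single_le_sum (fun _ _ => Nat.zero_le _) _ (sup_mem_of_ne_zero h)
  · have h1 := Multiset.card_le_card (Multiset.filter_le (fun i => s.count 1 < i) s)
    have h2 := card_le_sum_of_pos hs
    omega

theorem neg_sum_le_multisetCrank {s : Multiset ℕ} (hs : ∀ i ∈ s, 0 < i) :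
    -(s.sum : ℤ) ≤ multisetCrank s := by
  rw [multisetCrank]
  split_ifs
  · omega
  · have h1 := Multiset.count_le_card 1 s
    have h2 := card_le_sum_of_pos hs
    omega

theorem sum_crankOne (j : ℤ) :
    ∑ m ∈ Finset.Icc j 1, crankOne m = (if j ≤ -1 then 1 else 0) + (if j = 1 then 1 else 0) := by
  rcases lt_trichotomy j 0 with h | rfl | h
  · rw [if_pos (by omega), if_neg (by omega),
      ← Finset.sum_subset (Finset.Icc_subset_Icc_left (show j ≤ -1 by omega))]
    · decide
    · intro m hm hm'
      rw [Finset.mem_Icc] at hm hm'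
      rw [crankOne, if_neg (by omega), if_neg (by omega)]
  · decide
  · rcases eq_or_ne j 1 with rfl | h1
    · decide
    · rw [if_neg (by omega), if_neg h1, Finset.Icc_eq_empty (by omega), Finset.sum_empty, add_zero]

/-- The exceptional values at `1` differ from the true partition counts for `j = 1` only. -/
theorem crankGeGF_eq (j : ℤ) :
    crankGeGF j = gf (fun s => j ≤ multisetCrank s) + if j = 1 then X else 0 := by
  ext n
  rw [crankGeGF, coeff_mk, numCrankGe, map_add, coeff_gf]
  by_cases hn : n = 1
  · subst hn
    rw [if_pos rfl, sum_crankOne]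
    have h1 : Nat.card {p : Nat.Partition 1 // j ≤ multisetCrank p.parts} =
        if j ≤ -1 then 1 else 0 := by
      have h2 : multisetCrank {1} = -1 := by decide
      simp only [Nat.Partition.partition_one_parts, h2]
      split_ifs with h <;> simp [h]
    rw [h1]
    split_ifs <;> norm_num
  · rw [if_neg hn, Nat.card_eq_fintype_card, Fintype.card_subtype]
    have h1 : coeff n (if j = 1 then X else 0 : PowerSeries ℚ) = 0 := by
      split_ifs <;> simp [coeff_X, hn]
    rw [h1, add_zero, Int.cast_natCast]
    rfl

theorem crankGeGF_sub (j : ℤ) :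
    crankGeGF j - crankGeGF (j + 1) = gf (fun s => multisetCrank s = j) +
      ((if j = 1 then X else 0) - if j = 0 then X else 0) := by
  have h1 := gf_and_add_gf_and_not (fun s => j ≤ multisetCrank s) (fun s => multisetCrank s = j)
  have h2 : gf (fun s => j ≤ multisetCrank s ∧ multisetCrank s = j) =
      gf (fun s => multisetCrank s = j) := gf_congr fun s _ => by omega
  have h3 : gf (fun s => j ≤ multisetCrank s ∧ ¬ multisetCrank s = j) =
      gf (fun s => j + 1 ≤ multisetCrank s) := gf_congr fun s _ => by omega
  rw [h2, h3] at h1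
  rw [crankGeGF_eq, crankGeGF_eq, ← h1]
  simp only [add_eq_right]
  ring

theorem coeff_crankGeGF_of_lt {j : ℤ} {n : ℕ} (hj : (n : ℤ) < j) (hj1 : j ≠ 1) :
    coeff n (crankGeGF j) = 0 := by
  rw [crankGeGF_eq, if_neg hj1, add_zero]
  refine coeff_gf_eq_zero fun p hp => ?_
  have := multisetCrank_le_sum fun i hi => p.parts_pos hi
  rw [p.parts_sum] at this
  omega

theorem coeff_crankGeGF_of_le {j : ℤ} {n : ℕ} (hj : j ≤ -n) :
    coeff n (crankGeGF j) = coeff n (gf fun _ => True) := by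
  rw [crankGeGF_eq, if_neg (by omega), add_zero, coeff_gf, coeff_gf]
  congr 1
  refine Nat.card_congr (Equiv.subtypeEquivRight fun p => ?_)
  have := neg_sum_le_multisetCrank fun i hi => p.parts_pos hi
  rw [p.parts_sum] at this
  exact iff_of_true (by omega) trivial

theorem _root_.HasSum.congr_arg {f g : ℕ → PowerSeries ℚ} {a : PowerSeries ℚ} (hf : HasSum f a)
    (h : f = g) : HasSum g a := h ▸ hf

/-- The generating function of the partitions with `w` ones and `w + m` parts larger than `w`
(for `w ≥ 1`). -/
noncomputable def crankTerm (m w : ℕ) : PowerSeries ℚ :=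
  X ^ w * (1 - X) * qFacInv w * (X ^ ((w + 1) * (w + m)) * qFacInv (w + m))

/-- The exceptional values at n = 1 repair the cases m = 0, 1: the uniform formula gives 1 - q and
q, the true counts give 1 and 0. -/
theorem gf_count_one_eq_zero_sup_add (m : ℕ) :
    gf (fun s => s.count 1 = 0 ∧ s.sup = m) +
      ((if (m : ℤ) = 1 then X else 0) - if (m : ℤ) = 0 then X else 0) = crankTerm m 0 := by
  match m with
  | 0 =>
    rw [gf_count_one_eq_zero_sup_zero]
    simp [crankTerm, sub_eq_add_neg]
  | 1 =>
    rw [gf_count_one_eq_zero_sup_one]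
    simp [crankTerm]
    linear_combination (-X : PowerSeries ℚ) * qFacInv_one
  | m + 2 =>
    rw [gf_count_one_eq_zero_sup, if_neg (by omega), if_neg (by omega)]
    simp [crankTerm]


theorem hasSum_crankTerm (m : ℕ) :
    HasSum (crankTerm m) (crankGeGF m - crankGeGF (m + 1)) := by
  rw [crankGeGF_sub]
  refine ((hasSum_gf (fun s => multisetCrank s = m) (Multiset.count 1)).add
    (hasSum_ite_eq 0 ((if (m : ℤ) = 1 then X else 0) -
      if (m : ℤ) = 0 then X else 0))).congr_arg ?_
  funext w
  rcases Nat.eq_zero_or_pos w with rfl | hw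
  · rw [if_pos rfl, ← gf_count_one_eq_zero_sup_add]
    congr 1
    refine gf_congr fun s _ => ?_
    rw [and_comm]
    refine and_congr_right fun h => ?_
    rw [multisetCrank, if_pos h, Nat.cast_inj]
  · rw [if_neg hw.ne', add_zero, crankTerm, ← gf_count_one_card_filter _ _ hw]
    refine gf_congr fun s _ => ?_
    rw [and_comm]
    refine and_congr_right fun h => ?_
    rw [multisetCrank, h, if_neg hw.ne']
    omega

/-- The crank is symmetric: the values `m + 1` and `-(m + 1)` are equally frequent. -/
theorem hasSum_crankTerm_neg (m : ℕ) :
    HasSum (crankTerm (m + 1)) (crankGeGF (-(m + 1 : ℤ)) - crankGeGF (-(m + 1 : ℤ) + 1)) := by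
  rw [crankGeGF_sub, if_neg (by omega), if_neg (by omega), sub_zero, add_zero]
  refine (hasSum_gf (fun s => multisetCrank s = -(m + 1 : ℤ))
    (fun s => (s.filter (s.count 1 < ·)).card)).congr_arg ?_
  funext N
  -- The term is symmetric under exchanging the number of ones with the number of parts exceeding
  -- it: here these are N + m + 1 and N.
  have h1 : crankTerm (m + 1) N = X ^ (N + (m + 1)) * (1 - X) * qFacInv (N + (m + 1)) *
      (X ^ ((N + (m + 1) + 1) * N) * qFacInv N) := by
    rw [crankTerm]
    ring
  rw [h1, ← gf_count_one_card_filter _ _ (by omega)]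
  refine gf_congr fun s _ => ?_
  rw [multisetCrank]
  constructor
  · rintro ⟨h, h'⟩
    split_ifs at h with h0
    · omega
    · have h2 : s.count 1 = N + (m + 1) := by omega
      exact ⟨h2, h2 ▸ h'⟩
  · rintro ⟨h, h'⟩
    rw [h, if_neg (by omega), h']
    exact ⟨by push_cast; ring, rfl⟩

/-! ### Durfee-type sums and the crank recurrence -/

theorem summable_of_X_pow_dvd {f : ℕ → PowerSeries ℚ} (hf : ∀ w, X ^ w ∣ f w) : Summable f := by
  rw [WithPiTopology.summable_iff_summable_coeff]
  intro n
  refine summable_of_ne_finset_zero (s := Finset.range (n + 1)) fun w hw => ?_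
  rw [Finset.mem_range] at hw
  exact X_pow_dvd_iff.1 (hf w) n (by omega)

/-- Dropping the vanishing term `p 0` reindexes one part of the series. In the applications `p`
carries a factor 1 - q^w, which after the shift cancels the last factor of (q)_{w+1}. -/
theorem hasSum_shift_add {p r : ℕ → PowerSeries ℚ} {a : PowerSeries ℚ} (hp : Summable p)
    (hp0 : p 0 = 0) (h : HasSum (fun w => p w + r w) a) :
    HasSum (fun w => p (w + 1) + r w) a := by
  have h1 : HasSum (fun w => p (w + 1)) (∑' w, p w) := by
    rw [hasSum_nat_add_iff 1]
    simpa [hp0] using hp.hasSum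
  simpa using h1.add (h.sub hp.hasSum)

/-- The summand of `durfeeSum`. -/
noncomputable def durfeeTerm (j w : ℕ) : PowerSeries ℚ :=
  X ^ (w * (w + j + 1)) * (qFacInv w * qFacInv (w + j))

theorem summable_durfeeTerm (j : ℕ) : Summable (durfeeTerm j) :=
  summable_of_X_pow_dvd fun _ =>
    Dvd.dvd.mul_right (pow_dvd_pow _ (Nat.le_mul_of_pos_right _ (by omega))) _

/-- The sum `∑_{w ≥ 0} q ^ (w * (w + j + 1)) / ((q)_w (q)_{w + j})`. -/
noncomputable def durfeeSum (j : ℕ) : PowerSeries ℚ := ∑' w, durfeeTerm j w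

theorem hasSum_durfeeTerm (j : ℕ) : HasSum (durfeeTerm j) (durfeeSum j) :=
  (summable_durfeeTerm j).hasSum

theorem crankGeGF_sub_eq_durfeeSum (m : ℕ) :
    crankGeGF m - crankGeGF (m + 1) =
      X ^ m * durfeeSum m - X ^ (m + 1) * durfeeSum (m + 1) := by
  have h1 := ((hasSum_durfeeTerm m).mul_left (X ^ m)).sub (hasSum_crankTerm m)
  -- The summand of `h1` is q^m `durfeeTerm m w` times 1 - q^w + q^(w+1): the factor 1 - q^w goes
  -- into `p`, the rest into `r`.
  have h2 := hasSum_shift_add (p := fun w => X ^ m * durfeeTerm m w * (1 - X ^ w))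
    (r := fun w => X ^ ((w + 1) * (w + m + 1)) * (qFacInv w * qFacInv (w + m)))
    (summable_of_X_pow_dvd fun w => by
      rw [durfeeTerm]
      exact (((pow_dvd_pow _ (Nat.le_mul_of_pos_right _ (by omega))).mul_right _).mul_left
        _).mul_right _) (by simp)
    (h1.congr_arg (by
      funext w
      rw [durfeeTerm, crankTerm]
      ring))
  have h3 := h2.unique (((hasSum_durfeeTerm (m + 1)).mul_left (X ^ (m + 1))).congr_arg (by
    funext w
    have e1 := qFacInv_succ w
    have e2 := qFacInv_succ (w + m)
    simp only [durfeeTerm]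
    rw [show w + 1 + m = w + m + 1 by ring, show w + (m + 1) = w + m + 1 by ring, ← e2]
    linear_combination (-X ^ (m + (w + 1) * (w + 1 + m + 1)) * qFacInv (w + m + 1)) * e1))
  linear_combination -h3

theorem crankGeGF_eq_durfeeSum (m : ℕ) : crankGeGF m = X ^ m * durfeeSum m := by
  have h1 : ∀ k : ℕ, crankGeGF m - X ^ m * durfeeSum m =
      crankGeGF (m + k : ℕ) - X ^ (m + k) * durfeeSum (m + k) := by
    intro k
    induction k with
    | zero => rfl
    | succ k ih =>
      have := crankGeGF_sub_eq_durfeeSum (m + k)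
      rw [ih, ← add_assoc, Nat.cast_succ]
      linear_combination this
  rw [← sub_eq_zero]
  ext n
  -- The shift `n + 2`, rather than `n + 1`, keeps the index away from the exceptional value 1.
  rw [h1 (n + 2), map_sub, coeff_crankGeGF_of_lt (by omega) (by omega), coeff_X_pow_mul',
    if_neg (by omega)]
  simp

/-- Over the common denominator (q)_w (q)_{w+j+1} the two terms on the left collapse to
q^(w(w+j+1)); splitting 1 = (1 - q^w) + q^w and shifting the first piece gives the right side. -/
theorem durfeeSum_add_succ (j : ℕ) :
    durfeeSum j + X ^ (j + 1) * durfeeSum (j + 1) =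
      durfeeSum (j + 1) + X ^ (j + 2) * durfeeSum (j + 2) := by
  have h1 := (hasSum_durfeeTerm j).add ((hasSum_durfeeTerm (j + 1)).mul_left (X ^ (j + 1)))
  have h2 := hasSum_shift_add
    (p := fun w => X ^ (w * (w + j + 1)) * (qFacInv w * qFacInv (w + j + 1)) * (1 - X ^ w))
    (r := durfeeTerm (j + 1))
    (summable_of_X_pow_dvd fun w =>
      ((pow_dvd_pow _ (Nat.le_mul_of_pos_right _ (by omega))).mul_right _).mul_right _) (by simp)
    (h1.congr_arg (by
      funext w
      have e2 := qFacInv_succ (w + j)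
      simp only [durfeeTerm]
      rw [show w + (j + 1) = w + j + 1 by ring, ← e2]
      ring))
  refine h2.unique ?_
  rw [add_comm (durfeeSum _)]
  refine (((hasSum_durfeeTerm (j + 2)).mul_left (X ^ (j + 2))).add
    (hasSum_durfeeTerm (j + 1))).congr_arg ?_
  funext w
  have e1 := qFacInv_succ w
  simp only [durfeeTerm]
  rw [← e1]
  ring_nf

/-- By crank symmetry the sum does not depend on `m`; for large `m` the first summand counts
everything up to a given degree and the second nothing. -/
theorem crankGeGF_neg_add (m : ℕ) :
    crankGeGF (-m) + crankGeGF (m + 1) = gf fun _ => True := by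
  have h1 : ∀ k : ℕ, crankGeGF (-(k : ℤ)) + crankGeGF (k + 1) = crankGeGF 0 + crankGeGF 1 := by
    intro k
    induction k with
    | zero => simp
    | succ k ih =>
      have h2 := (hasSum_crankTerm_neg k).unique (hasSum_crankTerm (k + 1))
      rw [show -((k : ℤ) + 1) + 1 = -k by ring] at h2
      push_cast at h2 ⊢
      rw [← ih]
      linear_combination h2
  rw [h1 m]
  ext n
  rw [← h1 (n + 1), map_add, coeff_crankGeGF_of_le (by push_cast; omega),
    coeff_crankGeGF_of_lt (by push_cast; omega) (by omega), add_zero]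

/-- The fundamental recurrence for the cumulative crank generating functions. -/
theorem crankGeGF_recurrence (m : ℕ) :
    crankGeGF m + X ^ m * crankGeGF (m + 1) = X ^ m * gf fun _ => True := by
  have h1 : durfeeSum m + X ^ (m + 1) * durfeeSum (m + 1) = gf fun _ => True := by
    induction m with
    | zero =>
      rw [← crankGeGF_neg_add 0, ← crankGeGF_eq_durfeeSum]
      have := crankGeGF_eq_durfeeSum 0
      simp_all
    | succ m ih => exact (durfeeSum_add_succ m).symm.trans ih
  have h2 := crankGeGF_eq_durfeeSum (m + 1)
  push_cast at h2
  rw [crankGeGF_eq_durfeeSum, h2, ← h1]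
  ring

/-! ### Alternating sums as Laurent series -/

/-- The summable family of monomials `c n * q ^ e n`, for exponents tending to infinity. -/
noncomputable def monomialFamily (e : ℕ → ℤ) (c : ℕ → ℚ) (he : Tendsto e atTop atTop) :
    HahnSeries.SummableFamily ℤ ℚ ℕ where
  toFun n := HahnSeries.single (e n) (c n)
  isPWO_iUnion_support' := by
    obtain ⟨b, hb⟩ := bddBelow_range_of_tendsto_atTop_atTop he
    refine (BddBelow.isWF ⟨b, fun x hx => ?_⟩).isPWO
    obtain ⟨n, hn⟩ := Set.mem_iUnion.1 hx
    rw [Set.mem_singleton_iff.1 (HahnSeries.support_single_subset hn)]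
    exact hb ⟨n, rfl⟩
  finite_co_support' g := by
    obtain ⟨N, hN⟩ := eventually_atTop.1 (he.eventually_gt_atTop g)
    refine (Set.finite_Iio N).subset fun n hn => ?_
    rw [Set.mem_Iio]
    by_contra h
    exact hn (HahnSeries.coeff_single_of_ne (hN n (not_lt.1 h)).ne)

theorem monomialFamily_apply (e : ℕ → ℤ) (c : ℕ → ℚ) (he : Tendsto e atTop atTop) (n : ℕ) :
    monomialFamily e c he n = HahnSeries.single (e n) (c n) := rfl

theorem hasSum_coeff_hsum (s : HahnSeries.SummableFamily ℤ ℚ ℕ) (g : ℤ) :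
    HasSum (fun n => (s n).coeff g) (s.hsum.coeff g) := by
  rw [HahnSeries.SummableFamily.coeff_hsum]
  have h := s.finite_co_support g
  rw [← tsum_eq_finsum (L := .unconditional ℕ) h]
  exact (summable_of_hasFiniteSupport h).hasSum

/-- The exponents `n (n + 1) / 2 + (n + 1) j`. -/
def triExp (j : ℤ) (n : ℕ) : ℤ := ((n : ℤ) + 1) * n / 2 + ((n : ℤ) + 1) * j

theorem two_mul_triExp (j : ℤ) (n : ℕ) :
    2 * triExp j n = ((n : ℤ) + 1) * n + 2 * (((n : ℤ) + 1) * j) := by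
  rw [triExp, mul_add, Int.mul_ediv_cancel' ]
  rw [mul_comm]
  exact (Int.even_mul_succ_self n).two_dvd

theorem tendsto_triExp (j : ℤ) : Tendsto (triExp j) atTop atTop := by
  refine tendsto_atTop_mono' _ ?_ tendsto_natCast_atTop_atTop
  filter_upwards [eventually_ge_atTop (2 - 2 * j).toNat] with n hn
  -- Twice the exponent is (n + 1)(n + 2j), and this bound makes the second factor at least 2.
  have h1 : 2 - 2 * j ≤ n := by omega
  have h2 := two_mul_triExp j n
  nlinarith

/-- The alternating sum `∑_{n ≥ 0} (-1) ^ n * q ^ (n (n + 1) / 2 + (n + 1) j)`. -/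
noncomputable def triFamily (j : ℤ) : HahnSeries.SummableFamily ℤ ℚ ℕ :=
  monomialFamily (triExp j) (fun n => (-1) ^ n) (tendsto_triExp j)

theorem triFamily_apply (j : ℤ) (n : ℕ) :
    triFamily j n = HahnSeries.single (triExp j n) ((-1) ^ n) := rfl

theorem coeff_qPow_mul (j g : ℤ) (f : LaurentSeries ℚ) :
    (qPow j * f).coeff g = f.coeff (g - j) := by
  rw [qPow]
  have := HahnSeries.coeff_single_mul_add (r := (1 : ℚ)) (x := f) (a := g - j) (b := j)
  rw [sub_add_cancel, one_mul] at this
  exact this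

/-- The term n = 0 is q^j; each later term is -q^j times the preceding term of the family for `j +
1`. -/
theorem hsum_triFamily_recurrence (j : ℤ) :
    (triFamily j).hsum + qPow j * (triFamily (j + 1)).hsum = qPow j := by
  ext g
  rw [HahnSeries.coeff_add, coeff_qPow_mul]
  have h1 := (hasSum_nat_add_iff' 1).2 (hasSum_coeff_hsum (triFamily j) g)
  have h2 := (hasSum_coeff_hsum (triFamily (j + 1)) (g - j)).neg
  have h3 : (fun n => ((triFamily j) (n + 1)).coeff g) =
      fun n => -((triFamily (j + 1)) n).coeff (g - j) := by
    funext n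
    have h4 : triExp j (n + 1) = triExp (j + 1) n + j := by
      have := two_mul_triExp j (n + 1)
      have := two_mul_triExp (j + 1) n
      push_cast at *
      linarith
    rw [triFamily_apply, triFamily_apply, h4, HahnSeries.coeff_single, HahnSeries.coeff_single]
    by_cases h : g = triExp (j + 1) n + j
    · rw [if_pos h, if_pos (by omega)]
      ring
    · rw [if_neg h, if_neg (by omega), neg_zero]
  rw [h3] at h1
  have h5 := h1.unique h2
  rw [Finset.sum_range_one, triFamily_apply, pow_zero] at h5
  have h6 : triExp j 0 = j := by simp [triExp]
  rw [h6] at h5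
  rw [qPow]
  linarith

theorem coeff_hsum_triFamily_of_neg (m : ℕ) {g : ℤ} (hg : g < 0) :
    (triFamily m).hsum.coeff g = 0 := by
  rw [HahnSeries.SummableFamily.coeff_hsum]
  refine (finsum_congr fun n => ?_).trans finsum_zero
  refine HahnSeries.coeff_single_of_ne ?_
  have := two_mul_triExp m n
  have : (0 : ℤ) ≤ ((n : ℤ) + 1) * n + 2 * (((n : ℤ) + 1) * m) := by positivity
  omega

theorem qPow_add (a b : ℤ) : qPow (a + b) = qPow a * qPow b := by
  simp [qPow]

theorem qPow_zero : qPow 0 = 1 := rfl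

theorem coe_X_pow (m : ℕ) : ((X ^ m : PowerSeries ℚ) : LaurentSeries ℚ) = qPow m := by
  simp [qPow]

/-! ### Identification of the two solutions of the recurrence -/

theorem coe_crankGeGF_mul_qInf_recurrence (m : ℕ) :
    ((crankGeGF m * qInf : PowerSeries ℚ) : LaurentSeries ℚ) +
      qPow m * ((crankGeGF (m + 1) * qInf : PowerSeries ℚ) : LaurentSeries ℚ) = qPow m := by
  rw [← coe_X_pow, ← PowerSeries.coe_mul, ← PowerSeries.coe_add]
  congr 1
  linear_combination qInf * crankGeGF_recurrence m + X ^ m * gf_true_mul_qInf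

theorem coe_crankGeGF_mul_qInf_natCast (m : ℕ) :
    ((crankGeGF m * qInf : PowerSeries ℚ) : LaurentSeries ℚ) = (triFamily m).hsum := by
  set D : ℕ → LaurentSeries ℚ := fun m =>
    ((crankGeGF m * qInf : PowerSeries ℚ) : LaurentSeries ℚ) - (triFamily m).hsum with hD
  have hrec : ∀ m, D m = -(qPow m * D (m + 1)) := by
    intro m
    have h1 := coe_crankGeGF_mul_qInf_recurrence m
    have h2 := hsum_triFamily_recurrence m
    simp only [hD]
    push_cast
    push_cast at h1
    linear_combination h1 - h2
  -- Each use of `hrec` at a positive index raises the order by at least one; index 0 gains nothing,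
  -- so it is treated afterwards.
  have hcoeff : ∀ (B m : ℕ) (g : ℤ), g < B → (D (m + 1)).coeff g = 0 := by
    intro B
    induction B with
    | zero =>
      intro m g hg
      simp only [hD]
      rw [HahnSeries.coeff_sub, coeff_hsum_triFamily_of_neg _ (by simpa using hg),
        PowerSeries.coeff_coe, if_pos (by simpa using hg), sub_zero]
    | succ B ih =>
      intro m g hg
      rw [hrec, HahnSeries.coeff_neg, coeff_qPow_mul, ih (m + 1) _ (by push_cast at *; omega),
        neg_zero]
  have hpos : ∀ m, D (m + 1) = 0 := by
    intro m
    ext g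
    exact hcoeff (g.toNat + 1) m g (by omega)
  refine sub_eq_zero.1 (show D m = 0 from ?_)
  rw [hrec, hpos, mul_zero, neg_zero]

/-- The counterpart of `crankGeGF_neg_add`, obtained from the recurrences at -(m + 1) and m + 1; it
carries the identity to negative indices. -/
theorem hsum_triFamily_neg_add (m : ℕ) :
    (triFamily (-m)).hsum + (triFamily (m + 1)).hsum = 1 := by
  induction m with
  | zero => simpa [qPow_zero] using hsum_triFamily_recurrence 0
  | succ m ih =>
    have h1 := hsum_triFamily_recurrence (-(m + 1 : ℤ))
    have h2 := hsum_triFamily_recurrence (m + 1)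
    have h3 : qPow (-(m + 1 : ℤ)) * qPow (m + 1) = 1 := by
      rw [← qPow_add, neg_add_cancel, qPow_zero]
    rw [show -((m : ℤ) + 1) + 1 = -m by ring] at h1
    push_cast
    linear_combination h1 - qPow (-(m + 1 : ℤ)) * ih + qPow (-(m + 1 : ℤ)) * h2 -
      (1 - (triFamily ((m : ℤ) + 1 + 1)).hsum) * -h3

theorem coe_crankGeGF_mul_qInf (j : ℤ) :
    ((crankGeGF j * qInf : PowerSeries ℚ) : LaurentSeries ℚ) = (triFamily j).hsum := by
  rcases Int.eq_nat_or_neg j with ⟨m, rfl | rfl⟩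
  · exact coe_crankGeGF_mul_qInf_natCast m
  · have h1 := hsum_triFamily_neg_add m
    have h2 := coe_crankGeGF_mul_qInf_natCast (m + 1)
    have h3 : crankGeGF (-m) * qInf = 1 - crankGeGF (m + 1) * qInf := by
      linear_combination qInf * crankGeGF_neg_add m + gf_true_mul_qInf
    push_cast at h2
    rw [h3, PowerSeries.coe_sub, PowerSeries.coe_one, PowerSeries.coe_mul, h2]
    linear_combination -h1

theorem coe_crankGeGF (j : ℤ) :
    (crankGeGF j : LaurentSeries ℚ) = 1 / (qInf : LaurentSeries ℚ) * (triFamily j).hsum := by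
  have h : (qInf : LaurentSeries ℚ) ≠ 0 := by
    intro h
    have h1 := congrArg (fun f : PowerSeries ℚ => (f : LaurentSeries ℚ)) gf_true_mul_qInf
    simp [PowerSeries.coe_mul, h] at h1
  rw [← coe_crankGeGF_mul_qInf, PowerSeries.coe_mul]
  field_simp

/-! ### Grouping in pairs and the final formulas -/

theorem tendsto_two_mul_add (b : ℕ) : Tendsto (fun k : ℕ => 2 * k + b) atTop atTop :=
  tendsto_atTop_mono (fun k => show k ≤ 2 * k + b by omega) tendsto_id

/-- The terms of `triFamily` grouped in consecutive pairs. -/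
noncomputable def triPairFamily (j : ℤ) : HahnSeries.SummableFamily ℤ ℚ ℕ :=
  monomialFamily (fun k => triExp j (2 * k)) (fun _ => 1)
      ((tendsto_triExp j).comp (tendsto_two_mul_add 0)) +
    monomialFamily (fun k => triExp j (2 * k + 1)) (fun _ => -1)
      ((tendsto_triExp j).comp (tendsto_two_mul_add 1))

theorem triPairFamily_apply (j : ℤ) (k : ℕ) :
    triPairFamily j k = triFamily j (2 * k) + triFamily j (2 * k + 1) := by
  simp [triPairFamily, monomialFamily_apply, triFamily_apply, pow_succ, pow_mul]

theorem hsum_eq_hsum_of_pairs {s t : HahnSeries.SummableFamily ℤ ℚ ℕ}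
    (hst : ∀ k, s k = t (2 * k) + t (2 * k + 1)) : s.hsum = t.hsum := by
  ext g
  refine (hasSum_coeff_hsum s g).unique ?_
  simp_rw [hst, HahnSeries.coeff_add]
  have h := hasSum_coeff_hsum t g
  have hfin := t.finite_co_support g
  have he : Summable fun k : ℕ => (t (2 * k)).coeff g :=
    summable_of_hasFiniteSupport (hfin.preimage (f := fun k => 2 * k) fun a _ b _ h => by
      simpa using h)
  have ho : Summable fun k : ℕ => (t (2 * k + 1)).coeff g :=
    summable_of_hasFiniteSupport (hfin.preimage (f := fun k => 2 * k + 1) fun a _ b _ h => by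
      simpa using h)
  have h1 := tsum_even_add_odd (f := fun n => (t n).coeff g) he ho
  rw [h.tsum_eq] at h1
  rw [← h1]
  exact he.hasSum.add ho.hasSum

theorem hsum_triPairFamily (j : ℤ) : (triPairFamily j).hsum = (triFamily j).hsum :=
  hsum_eq_hsum_of_pairs (triPairFamily_apply j)

end CrankGF

theorem mainTheorem7 (j : ℤ) :
    (∃ s : HahnSeries.SummableFamily ℤ ℚ ℕ,
      (∀ k : ℕ, s k = CrankGF.qPow (j * (2 * (k : ℤ) + 1) + (k : ℤ) * (2 * (k : ℤ) + 1)) *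
          (1 - CrankGF.qPow (2 * (k : ℤ) + j + 1))) ∧
      (CrankGF.crankGeGF j : LaurentSeries ℚ) =
        1 / (CrankGF.qInf : LaurentSeries ℚ) * s.hsum) ∧
    (∃ t : HahnSeries.SummableFamily ℤ ℚ ℕ+,
      (∀ n : ℕ+, t n = (-1) ^ ((n : ℕ) - 1) *
          CrankGF.qPow ((n : ℤ) * ((n : ℤ) - 1) / 2 + (n : ℤ) * j)) ∧
      (CrankGF.crankGeGF j : LaurentSeries ℚ) =
        1 / (CrankGF.qInf : LaurentSeries ℚ) * t.hsum) := by
  refine ⟨⟨CrankGF.triPairFamily j, fun k => ?_, ?_⟩,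
    ⟨HahnSeries.SummableFamily.Equiv Equiv.pnatEquivNat.symm (CrankGF.triFamily j),
      fun n => ?_, ?_⟩⟩
  · have h1 := CrankGF.two_mul_triExp j (2 * k)
    have h2 := CrankGF.two_mul_triExp j (2 * k + 1)
    push_cast at h1 h2
    rw [CrankGF.triPairFamily_apply, CrankGF.triFamily_apply, CrankGF.triFamily_apply, mul_sub,
      mul_one, ← CrankGF.qPow_add, CrankGF.qPow, CrankGF.qPow, sub_eq_add_neg,
      ← HahnSeries.single_neg]
    have h3 : CrankGF.triExp j (2 * k) = j * (2 * (k : ℤ) + 1) + (k : ℤ) * (2 * (k : ℤ) + 1) := by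
      linarith
    have h4 : CrankGF.triExp j (2 * k + 1) = j * (2 * (k : ℤ) + 1) + (k : ℤ) * (2 * (k : ℤ) + 1) +
        (2 * (k : ℤ) + j + 1) := by
      linarith
    rw [h3, h4]
    simp [pow_succ, pow_mul]
  · rw [CrankGF.hsum_triPairFamily, CrankGF.coe_crankGeGF]
  -- `triFamily` is indexed from 0, so its index is n - 1.
  · obtain ⟨m, rfl⟩ : ∃ m : ℕ, n = m.succPNat := ⟨n.natPred, by simp⟩
    change CrankGF.triFamily j (Equiv.pnatEquivNat m.succPNat) = _
    have h1 : Equiv.pnatEquivNat m.succPNat = m := by simp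
    have h2 : ((-1) ^ m : LaurentSeries ℚ) = HahnSeries.single 0 ((-1) ^ m) := by
      rw [← HahnSeries.C_apply, map_pow, map_neg, map_one]
    rw [h1, Nat.succPNat_coe, Nat.succ_sub_one, h2, CrankGF.qPow, HahnSeries.single_mul_single]
    simp [CrankGF.triFamily_apply, CrankGF.triExp]
  · rw [HahnSeries.SummableFamily.hsum_equiv, CrankGF.coe_crankGeGF]
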